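/- Let $X$ be a nonreflexive (real or complex) Banach space, regarded as a subspace of $X^{**}$ via the canonical embedding, and suppose that $X$ is $M$-embedded: there is a linear projection $P:X^{***}\to X^{***}$ with $\ker P=X^{\perp}=\{\varphi\in X^{***}:\varphi|_X=0\}$ and $\|\varphi\|=\|P\varphi\|+\|\varphi-P\varphi\|$ for all $\varphi\in X^{***}$. Then: (1) There is a norm-closed subspace $Y$ of $X^{**}$ with $Y\setminus X\neq\emptyset$ such that $Y^{**}=X^{**}$, in the following sense: there is a surjective linear isometry $T:X^*\to Y^*$ whose adjoint $T^*:Y^{**}\to X^{**}$ (again a surjective linear isometry) maps the canonical image of each $y\in Y$ in $Y^{**}$ to $y$ itself. (2) Consequently, the identity map $\mathrm{id}:(B(X^{**}),w^*)\to(B(X^{**}),w)$ has no point of continuity, where $B(X^{**})$ is the closed unit ball of $X^{**}$, $w^*=\sigma(X^{**},X^*)$ and $w=\sigma(X^{**},X^{***})$. -/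

import Mathlib

open scoped Topology

noncomputable section

/-- The linear subspaces of a normed space, with the vector space structure read off from its
normed space structure. -/
abbrev NormedSubspace (𝕜 E : Type*) [RCLike 𝕜] [NormedAddCommGroup E] [NormedSpace 𝕜 E] :
    Type _ :=
  Submodule 𝕜 E

/-- The annihilator `Y^⊥ = {f ∈ E^* : f = 0 on Y}` of a subspace `Y` of a normed space `E`. -/
def dualAnnihilatorOf (𝕜 : Type*) {E : Type*} [RCLike 𝕜] [NormedAddCommGroup E]
    [NormedSpace 𝕜 E] (Y : NormedSubspace 𝕜 E) : NormedSubspace 𝕜 (StrongDual 𝕜 E) where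
  carrier := {f | ∀ y ∈ Y, f y = 0}
  zero_mem' := fun _ _ => rfl
  add_mem' := fun {f g} hf hg y hy => by
    rw [add_apply, hf y hy, hg y hy, add_zero]
  smul_mem' := fun c f hf y hy => by
    rw [smul_apply, hf y hy, smul_zero]

/-- A closed subspace `Y` of `E` is an M-ideal in `E` if there is an L-projection `P` of `E^*`
(an idempotent with `‖f‖ = ‖P f‖ + ‖f - P f‖` for all `f`) whose kernel is `Y^⊥`. -/
def IsMIdeal (𝕜 : Type*) {E : Type*} [RCLike 𝕜] [NormedAddCommGroup E]
    [NormedSpace 𝕜 E] (Y : NormedSubspace 𝕜 E) : Prop :=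
  IsClosed (Y : Set E) ∧
    ∃ P : StrongDual 𝕜 E →L[𝕜] StrongDual 𝕜 E,
      IsLprojection (StrongDual 𝕜 E) P ∧
        LinearMap.ker (P : StrongDual 𝕜 E →ₗ[𝕜] StrongDual 𝕜 E) = dualAnnihilatorOf 𝕜 Y

/-- The canonical image of `X` in its bidual, as a subspace of `X^{**}`. -/
def canonicalImage (𝕜 X : Type*) [RCLike 𝕜] [NormedAddCommGroup X] [NormedSpace 𝕜 X] :
    NormedSubspace 𝕜 (StrongDual 𝕜 (StrongDual 𝕜 X)) :=
  LinearMap.range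
    (NormedSpace.inclusionInDoubleDual 𝕜 X : X →ₗ[𝕜] StrongDual 𝕜 (StrongDual 𝕜 X))

/-- `X` is M-embedded if its canonical image is an M-ideal in `X^{**}`. -/
def IsMEmbedded (𝕜 X : Type*) [RCLike 𝕜] [NormedAddCommGroup X] [NormedSpace 𝕜 X] : Prop :=
  IsMIdeal 𝕜 (canonicalImage 𝕜 X)

/-- `X` is reflexive if the canonical embedding `X → X^{**}` is onto. -/
def IsReflexiveSpace (𝕜 X : Type*) [RCLike 𝕜] [NormedAddCommGroup X] [NormedSpace 𝕜 X] : Prop :=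
  Function.Surjective (NormedSpace.inclusionInDoubleDual 𝕜 X)

/-- The identity of `E^*`, from the weak-star topology to the weak topology. -/
def idWeakStarToWeak (𝕜 E : Type*) [RCLike 𝕜] [NormedAddCommGroup E] [NormedSpace 𝕜 E] :
    WeakDual 𝕜 E → WeakSpace 𝕜 (StrongDual 𝕜 E) :=
  fun f => toWeakSpace 𝕜 (StrongDual 𝕜 E) (WeakDual.toStrongDual f)

/-- `f` belongs to the closed unit ball `B(E^*)` and is a point of continuity of
`id : (B(E^*), w^*) → (B(E^*), w)`. -/
def IsWeakStarWeakContinuityPoint (𝕜 : Type*) {E : Type*} [RCLike 𝕜] [NormedAddCommGroup E]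
    [NormedSpace 𝕜 E] (f : StrongDual 𝕜 E) : Prop :=
  f ∈ Metric.closedBall (0 : StrongDual 𝕜 E) 1 ∧
    ContinuousWithinAt (idWeakStarToWeak 𝕜 E)
      (WeakDual.toStrongDual ⁻¹' Metric.closedBall (0 : StrongDual 𝕜 E) 1)
      (StrongDual.toWeakDual f)

/-- For a linear isometric embedding `ι : W → X^{**}`, the assertion that `W^{**} = X^{**}` along
`ι`: there is a surjective linear isometry `T : X^* → W^*` whose adjoint is a surjective linear
isometry `Φ : W^{**} → X^{**}` that agrees with `ι` on the canonical copy of `W` in `W^{**}`. -/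
def IsBidualAlong (𝕜 : Type*) {X W : Type*} [RCLike 𝕜] [NormedAddCommGroup X] [NormedSpace 𝕜 X]
    [NormedAddCommGroup W] [NormedSpace 𝕜 W]
    (ι : W →ₗᵢ[𝕜] StrongDual 𝕜 (StrongDual 𝕜 X)) : Prop :=
  ∃ (T : StrongDual 𝕜 X ≃ₗᵢ[𝕜] StrongDual 𝕜 W)
    (Φ : StrongDual 𝕜 (StrongDual 𝕜 W) ≃ₗᵢ[𝕜] StrongDual 𝕜 (StrongDual 𝕜 X)),
      (∀ (ψ : StrongDual 𝕜 (StrongDual 𝕜 W)) (f : StrongDual 𝕜 X), Φ ψ f = ψ (T f)) ∧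
        ∀ w : W, Φ (NormedSpace.inclusionInDoubleDual 𝕜 W w) = ι w

/-- For a subspace `Y` of `X^{**}`, the assertion `Y^{**} = X^{**}`, compatibly with the inclusion
of `Y` in `X^{**}`. -/
def HasSameBidual (𝕜 : Type*) {X : Type*} [RCLike 𝕜] [NormedAddCommGroup X] [NormedSpace 𝕜 X]
    (Y : NormedSubspace 𝕜 (StrongDual 𝕜 (StrongDual 𝕜 X))) : Prop :=
  IsBidualAlong 𝕜 (X := X) (W := Y) Y.subtypeₗᵢ

end

/-! Let `f ∈ X^*` be nonzero. Choose `z ∈ X^{**} \ X` with `z f = 0` and `‖z‖ ‖f‖ ≤ 1`, and tilt `X`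
to `Y = {x + f(x) z : x ∈ X}`. Extend a functional on `Y` to `ψ` on `X^{**}` with the same norm, and
split `ψ = h + ρ` with `h ∈ X^*`, `ρ ∈ X^⊥`. On `Y` it is evaluation at `h + ρ(z) f`, whose norm is
at most `‖h‖ + ‖ρ‖ = ‖ψ‖` because `X` is M-embedded. Hence `Y^* = X^*`, while `X ∩ Y` lies in the
kernel of `f`.

For the second part, the unit ball of a norming subspace is weak-star dense in the dual ball, so a
continuity point is in the weak closure of that subspace, hence in the subspace if it is closed. It
therefore lies in `X` and in `Y` for every `f`, which leaves only `0`. If `0` is a continuity point,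
translating and halving shows that every point of the ball lies in `X`, against nonreflexivity. -/

/-- The set of elements of norm at most one of a subspace `Y` of `E^*` that norms `E` is weak-star
dense in the closed unit ball of `E^*`. -/
theorem mem_closure_toWeakDual_image_of_norming {𝕜 E : Type*} [RCLike 𝕜] [NormedAddCommGroup E]
    [NormedSpace 𝕜 E] {Y : NormedSubspace 𝕜 (StrongDual 𝕜 E)}
    (hY : ∀ (e : E) (r : ℝ), 0 ≤ r → (∀ y ∈ Y, ‖y e‖ ≤ r * ‖y‖) → ‖e‖ ≤ r)
    {x : StrongDual 𝕜 E} (hx : ‖x‖ ≤ 1) :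
    StrongDual.toWeakDual x ∈ closure (StrongDual.toWeakDual '' {y | y ∈ Y ∧ ‖y‖ ≤ 1}) := by
  let _ : Module ℝ (WeakDual 𝕜 E) := WeakDual.instModule' ℝ
  have _ : LocallyConvexSpace ℝ (WeakDual 𝕜 E) :=
    inferInstanceAs (LocallyConvexSpace ℝ (WeakBilin (topDualPairing 𝕜 E)))
  by_contra hmem
  have hconv : Convex ℝ (closure (StrongDual.toWeakDual '' {y | y ∈ Y ∧ ‖y‖ ≤ 1})) := by
    refine Convex.closure ?_
    rintro _ ⟨y, ⟨hy, hy1⟩, rfl⟩ _ ⟨z, ⟨hz, hz1⟩, rfl⟩ a b ha hb hab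
    refine ⟨a • y + b • z, ⟨?_, ?_⟩, rfl⟩
    · have hsmul : ∀ (t : ℝ) (w : StrongDual 𝕜 E), t • w = (t : 𝕜) • w := fun t w => by
        ext v
        simp [RCLike.real_smul_eq_coe_mul]
      rw [hsmul a, hsmul b]
      exact Y.add_mem (Y.smul_mem _ hy) (Y.smul_mem _ hz)
    · have h := (convex_closedBall (0 : StrongDual 𝕜 E) 1)
        (mem_closedBall_zero_iff.2 hy1) (mem_closedBall_zero_iff.2 hz1) ha hb hab
      exact mem_closedBall_zero_iff.1 h
  obtain ⟨F, u, hF, hu⟩ := RCLike.geometric_hahn_banach_closed_point (𝕜 := 𝕜) hconv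
    isClosed_closure hmem
  -- Weak-star continuous functionals are evaluations at points of `E`.
  obtain ⟨e, he⟩ := LinearMap.dualEmbedding_surjective (topDualPairing 𝕜 E) F
  have hFe : ∀ y : StrongDual 𝕜 E, F (StrongDual.toWeakDual y) = y e := fun y => by
    rw [← he]; rfl
  have hle : ∀ y ∈ Y, ‖y‖ ≤ 1 → RCLike.re (y e) < u := fun y hy hy1 => by
    rw [← hFe]
    exact hF _ (subset_closure ⟨y, ⟨hy, hy1⟩, rfl⟩)
  have hu0 : 0 ≤ u := by
    simpa using (hle 0 Y.zero_mem (by simp)).le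
  have hbound : ∀ y ∈ Y, ‖y e‖ ≤ u * ‖y‖ := by
    intro y hy
    rcases eq_or_ne y 0 with rfl | hy0
    · simp
    have hn : 0 < ‖y‖ := norm_pos_iff.2 hy0
    -- A unimodular factor turns the bound on real parts into one on norms.
    obtain ⟨c, hc, hce⟩ := RCLike.exists_norm_eq_mul_self (y e)
    have key := hle ((((‖y‖⁻¹ : ℝ) : 𝕜) * c) • y) (Y.smul_mem _ hy) (by
      rw [norm_smul, norm_mul, hc, RCLike.norm_ofReal, abs_of_pos (inv_pos.2 hn), mul_one,
        inv_mul_cancel₀ hn.ne'])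
    rw [smul_apply, smul_eq_mul, mul_assoc, ← hce, ← RCLike.ofReal_mul, RCLike.ofReal_re,
      inv_mul_lt_iff₀ hn, mul_comm] at key
    exact key.le
  have hnorm := hY e u hu0 hbound
  rw [hFe] at hu
  have h1 : RCLike.re (x e) ≤ ‖e‖ :=
    (RCLike.re_le_norm _).trans ((x.le_opNorm e).trans
      (mul_le_of_le_one_left (norm_nonneg e) hx))
  linarith

/-- A point of a normed space outside a closed subspace is separated from it by a functional. -/
theorem exists_dual_forall_mem_eq_zero_apply_ne_zero {𝕜 E : Type*} [RCLike 𝕜]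
    [NormedAddCommGroup E] [NormedSpace 𝕜 E] {Y : NormedSubspace 𝕜 E}
    (hY : IsClosed (Y : Set E)) {x : E} (hx : x ∉ Y) :
    ∃ φ : StrongDual 𝕜 E, (∀ y ∈ Y, φ y = 0) ∧ φ x ≠ 0 := by
  -- Closedness makes the quotient a normed space, whose points are separated by functionals.
  have : IsClosed (Submodule.toAddSubgroup Y : Set E) := hY
  have hne : (Submodule.Quotient.mk x : E ⧸ Y) ≠ 0 := by
    rwa [Ne, Submodule.Quotient.mk_eq_zero]
  obtain ⟨f, hf⟩ := SeparatingDual.exists_ne_zero (R := 𝕜) hne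
  refine ⟨f.comp Y.mkQL, fun y hy => ?_, hf⟩
  have h0 : (Submodule.Quotient.mk y : E ⧸ Y) = 0 := (Submodule.Quotient.mk_eq_zero Y).2 hy
  change f (Submodule.Quotient.mk y) = 0
  rw [h0, map_zero]

/-- A functional that is constant on a part of the unit ball of `E^*` takes the same value at each
point of weak-star to weak continuity in the weak-star closure of that part. -/
theorem IsWeakStarWeakContinuityPoint.apply_eq_of_mem_closure {𝕜 E : Type*} [RCLike 𝕜]
    [NormedAddCommGroup E] [NormedSpace 𝕜 E] {x : StrongDual 𝕜 E}
    (hx : IsWeakStarWeakContinuityPoint 𝕜 x) {S : Set (StrongDual 𝕜 E)}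
    (hS : ∀ y ∈ S, ‖y‖ ≤ 1)
    (hxS : StrongDual.toWeakDual x ∈ closure (StrongDual.toWeakDual '' S))
    (φ : StrongDual 𝕜 (StrongDual 𝕜 E)) {c : 𝕜} (hφ : ∀ y ∈ S, φ y = c) : φ x = c := by
  have hsub : StrongDual.toWeakDual '' S ⊆
      WeakDual.toStrongDual ⁻¹' Metric.closedBall (0 : StrongDual 𝕜 E) 1 := by
    rintro _ ⟨y, hy, rfl⟩
    exact mem_closedBall_zero_iff.2 (hS y hy)
  have hφc : Continuous fun w : WeakSpace 𝕜 (StrongDual 𝕜 E) =>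
      φ ((toWeakSpace 𝕜 (StrongDual 𝕜 E)).symm w) :=
    WeakBilin.eval_continuous (topDualPairing 𝕜 (StrongDual 𝕜 E)).flip φ
  have hcont := hφc.continuousAt.comp_continuousWithinAt (hx.2.mono hsub)
  have hmem := hcont.mem_closure_image hxS
  have himg : ((fun w : WeakSpace 𝕜 (StrongDual 𝕜 E) =>
      φ ((toWeakSpace 𝕜 (StrongDual 𝕜 E)).symm w)) ∘ idWeakStarToWeak 𝕜 E) ''
        (StrongDual.toWeakDual '' S) ⊆ {c} := by
    rintro _ ⟨_, ⟨y, hy, rfl⟩, rfl⟩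
    exact hφ y hy
  have := closure_mono himg hmem
  rwa [closure_singleton] at this

/-- A point of weak-star to weak continuity belongs to every norm closed norming subspace. -/
theorem IsWeakStarWeakContinuityPoint.mem_of_norming {𝕜 E : Type*} [RCLike 𝕜]
    [NormedAddCommGroup E] [NormedSpace 𝕜 E] {x : StrongDual 𝕜 E}
    (hx : IsWeakStarWeakContinuityPoint 𝕜 x) {Y : NormedSubspace 𝕜 (StrongDual 𝕜 E)}
    (hYc : IsClosed (Y : Set (StrongDual 𝕜 E)))
    (hY : ∀ (e : E) (r : ℝ), 0 ≤ r → (∀ y ∈ Y, ‖y e‖ ≤ r * ‖y‖) → ‖e‖ ≤ r) : x ∈ Y := by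
  by_contra hxY
  obtain ⟨φ, hφ, hne⟩ := exists_dual_forall_mem_eq_zero_apply_ne_zero hYc hxY
  exact hne (hx.apply_eq_of_mem_closure (fun y hy => hy.2)
    (mem_closure_toWeakDual_image_of_norming hY (mem_closedBall_zero_iff.1 hx.1)) φ
    fun y hy => hφ y hy.1)

/-- If zero is a point of weak-star to weak continuity, then every norm closed norming subspace
is the whole dual. -/
theorem IsWeakStarWeakContinuityPoint.eq_top_of_norming {𝕜 E : Type*} [RCLike 𝕜]
    [NormedAddCommGroup E] [NormedSpace 𝕜 E]
    (h0 : IsWeakStarWeakContinuityPoint 𝕜 (0 : StrongDual 𝕜 E))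
    {Y : NormedSubspace 𝕜 (StrongDual 𝕜 E)} (hYc : IsClosed (Y : Set (StrongDual 𝕜 E)))
    (hY : ∀ (e : E) (r : ℝ), 0 ≤ r → (∀ y ∈ Y, ‖y e‖ ≤ r * ‖y‖) → ‖e‖ ≤ r) : Y = ⊤ := by
  have key : ∀ u : StrongDual 𝕜 E, ‖u‖ ≤ 1 → u ∈ Y := by
    intro u hu
    by_contra huY
    obtain ⟨φ, hφ, hne⟩ := exists_dual_forall_mem_eq_zero_apply_ne_zero hYc huY
    -- As `v` in the unit ball of `Y` tends weak-star to `u`, `(v - u)/2` tends to `0`. The half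
    -- keeps it in the unit ball, and `φ` is constantly `-φ(u)/2` there.
    let m : StrongDual 𝕜 E → StrongDual 𝕜 E := fun v => (2⁻¹ : 𝕜) • (v - u)
    have hm : Continuous fun w : WeakDual 𝕜 E => (2⁻¹ : 𝕜) • (w - StrongDual.toWeakDual u) :=
      WeakDual.continuous_of_continuous_eval fun e =>
        ((WeakDual.eval_continuous e).sub continuous_const).const_smul (2⁻¹ : 𝕜)
    have hcl : StrongDual.toWeakDual (0 : StrongDual 𝕜 E) ∈
        closure (StrongDual.toWeakDual '' (m '' {y | y ∈ Y ∧ ‖y‖ ≤ 1})) := by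
      have h := image_closure_subset_closure_image hm
        (Set.mem_image_of_mem _ (mem_closure_toWeakDual_image_of_norming hY hu))
      rw [sub_self, smul_zero, Set.image_image] at h
      rw [Set.image_image, map_zero]
      exact h
    have hval := h0.apply_eq_of_mem_closure (c := -((2⁻¹ : 𝕜) * φ u)) (S := m '' _)
      (by
        rintro _ ⟨v, hv, rfl⟩
        have h2 : ‖(2⁻¹ : 𝕜)‖ = 2⁻¹ := by rw [norm_inv, RCLike.norm_ofNat]
        rw [norm_smul, h2]
        have := norm_sub_le v u
        linarith [hv.2])
      hcl φ
      (by
        rintro _ ⟨v, hv, rfl⟩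
        simp [m, hφ v hv.1])
    rw [map_zero] at hval
    exact hne (by simpa using hval.symm)
  refine eq_top_iff.2 fun u _ => ?_
  have hn : (0 : ℝ) < ‖u‖ + 1 := by positivity
  have h := Y.smul_mem ((‖u‖ + 1 : ℝ) : 𝕜) (key ((((‖u‖ + 1)⁻¹ : ℝ) : 𝕜) • u) (by
    rw [norm_smul, RCLike.norm_ofReal, abs_of_pos (inv_pos.2 hn), inv_mul_le_iff₀ hn]
    linarith))
  rwa [smul_smul, ← RCLike.ofReal_mul, mul_inv_cancel₀ hn.ne', RCLike.ofReal_one, one_smul] at h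

/-! ### Biduals of M-embedded spaces -/

section

open NormedSpace

set_option maxSynthPendingDepth 3

variable {𝕜 X : Type*} [RCLike 𝕜] [NormedAddCommGroup X] [NormedSpace 𝕜 X]

/-- The canonical image of `X` in `X^{**}` norms `X^*`. -/
theorem norm_le_of_forall_mem_canonicalImage (f : StrongDual 𝕜 X) (r : ℝ) (hr : 0 ≤ r)
    (h : ∀ y ∈ canonicalImage 𝕜 X, ‖y f‖ ≤ r * ‖y‖) : ‖f‖ ≤ r := by
  refine f.opNorm_le_bound hr fun x => ?_
  rw [← (inclusionInDoubleDualLi (E := X) 𝕜).norm_map x]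
  exact h (inclusionInDoubleDual 𝕜 X x) ⟨x, rfl⟩

/-- A subspace of `X^{**}` with the same bidual as `X` norms `X^*`. -/
theorem HasSameBidual.norm_le {Y : NormedSubspace 𝕜 (StrongDual 𝕜 (StrongDual 𝕜 X))}
    (hY : HasSameBidual 𝕜 Y) (f : StrongDual 𝕜 X) (r : ℝ) (hr : 0 ≤ r)
    (h : ∀ y ∈ Y, ‖y f‖ ≤ r * ‖y‖) : ‖f‖ ≤ r := by
  obtain ⟨T, Φ, hΦ, hι⟩ := hY
  rw [← T.norm_map f]
  refine (T f).opNorm_le_bound hr fun y => ?_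
  have h1 : T f y = (y : StrongDual 𝕜 (StrongDual 𝕜 X)) f := by
    have h2 := hΦ (inclusionInDoubleDual 𝕜 Y y) f
    rw [hι, dual_def] at h2
    exact h2.symm
  rw [h1]
  exact h y y.2

/-- In the third dual of an M-embedded space, the norm is the sum of the norms of the two
components of the canonical decomposition. -/
theorem IsMEmbedded.norm_eq_add (hM : IsMEmbedded 𝕜 X)
    (φ : StrongDual 𝕜 (StrongDual 𝕜 (StrongDual 𝕜 X))) :
    ‖φ‖ = ‖φ.comp (inclusionInDoubleDual 𝕜 X)‖ +
      ‖φ - inclusionInDoubleDual 𝕜 (StrongDual 𝕜 X) (φ.comp (inclusionInDoubleDual 𝕜 X))‖ := by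
  obtain ⟨-, P, hP, hker⟩ := hM
  have hmem : ∀ ψ : StrongDual 𝕜 (StrongDual 𝕜 (StrongDual 𝕜 X)),
      P ψ = 0 ↔ ∀ x : X, ψ (inclusionInDoubleDual 𝕜 X x) = 0 := by
    intro ψ
    have h : P ψ = 0 ↔ ψ ∈ dualAnnihilatorOf 𝕜 (canonicalImage 𝕜 X) :=
      SetLike.ext_iff.1 hker ψ
    refine h.trans ⟨fun h x => h _ ⟨x, rfl⟩, ?_⟩
    rintro h _ ⟨x, rfl⟩
    exact h x
  have hL : ∀ ψ, ‖ψ‖ = ‖P ψ‖ + ‖ψ - P ψ‖ := hP.Lnorm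
  have hidem : ∀ ψ, P (P ψ) = P ψ := fun ψ => congrArg (fun Q => Q ψ) hP.proj
  -- `ψ` and `P ψ` agree on `X`, so `‖P ψ‖ ≥ ‖f‖ = ‖ψ‖`; the L-norm identity leaves no room for `ψ -
  -- P ψ`.
  have hfix : ∀ f : StrongDual 𝕜 X, P (inclusionInDoubleDual 𝕜 (StrongDual 𝕜 X) f) =
      inclusionInDoubleDual 𝕜 (StrongDual 𝕜 X) f := by
    intro f
    set ψ := inclusionInDoubleDual 𝕜 (StrongDual 𝕜 X) f with hψ
    have h0 : P (ψ - P ψ) = 0 := by rw [map_sub, hidem, sub_self]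
    have h1 := (hmem _).1 h0
    have hnorm : ‖ψ‖ = ‖f‖ := (inclusionInDoubleDualLi (E := StrongDual 𝕜 X) 𝕜).norm_map f
    have h2 : ‖f‖ ≤ ‖P ψ‖ := by
      refine f.opNorm_le_bound (norm_nonneg _) fun x => ?_
      have h3 := h1 x
      rw [sub_apply, sub_eq_zero, hψ, dual_def, dual_def] at h3
      rw [h3, ← (inclusionInDoubleDualLi (E := X) 𝕜).norm_map x]
      exact (P ψ).le_opNorm _
    have h4 := hL ψ
    have h5 : ‖ψ - P ψ‖ ≤ 0 := by linarith
    exact (sub_eq_zero.1 (norm_le_zero_iff.1 h5)).symm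
  have hPφ : P φ = inclusionInDoubleDual 𝕜 (StrongDual 𝕜 X)
      (φ.comp (inclusionInDoubleDual 𝕜 X)) := by
    rw [← hfix, ← sub_eq_zero, ← map_sub, hmem]
    intro x
    simp
  rw [hL φ, hPφ]
  congr 1
  exact (inclusionInDoubleDualLi (E := StrongDual 𝕜 X) 𝕜).norm_map _

/-- A subspace `Y` of `X^{**}` has the same bidual as `X` as soon as it separates the points of
`X^*` and every functional on `Y` is evaluation at an element of `X^*` of no larger norm. -/
theorem hasSameBidual_of_exists_eval {Y : NormedSubspace 𝕜 (StrongDual 𝕜 (StrongDual 𝕜 X))}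
    (hsep : ∀ f : StrongDual 𝕜 X, (∀ y ∈ Y, y f = 0) → f = 0)
    (hext : ∀ g : StrongDual 𝕜 Y, ∃ f : StrongDual 𝕜 X,
      ‖f‖ ≤ ‖g‖ ∧ ∀ y : Y, g y = (y : StrongDual 𝕜 (StrongDual 𝕜 X)) f) :
    HasSameBidual 𝕜 Y := by
  let T₀ : StrongDual 𝕜 X →ₗ[𝕜] StrongDual 𝕜 Y :=
    { toFun := fun f => (inclusionInDoubleDual 𝕜 (StrongDual 𝕜 X) f).comp Y.subtypeL
      map_add' := fun f g => by ext; simp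
      map_smul' := fun c f => by ext; simp }
  have hT₀ : ∀ f (y : Y), T₀ f y = (y : StrongDual 𝕜 (StrongDual 𝕜 X)) f := fun _ _ => rfl
  have hex : ∀ g : StrongDual 𝕜 Y, ∃ f, ‖f‖ ≤ ‖g‖ ∧ T₀ f = g := fun g => by
    obtain ⟨f, hf, hg⟩ := hext g
    exact ⟨f, hf, ContinuousLinearMap.ext fun y => (hg y).symm⟩
  have hinj : ∀ f, T₀ f = 0 → f = 0 := fun f hf => hsep f fun y hy => by
    rw [← hT₀ f ⟨y, hy⟩, hf, zero_apply]
  have hnorm : ∀ f, ‖T₀ f‖ = ‖f‖ := by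
    intro f
    refine le_antisymm ((T₀ f).opNorm_le_bound (norm_nonneg f) fun y => ?_) ?_
    · rw [hT₀, mul_comm]
      exact (y : StrongDual 𝕜 (StrongDual 𝕜 X)).le_opNorm f
    -- The representative of norm at most `‖T₀ f‖` must be `f` itself, by injectivity.
    · obtain ⟨f', hf', hT⟩ := hex (T₀ f)
      rwa [sub_eq_zero.1 (hinj (f' - f) (by rw [map_sub, hT, sub_self]))] at hf'
  let T : StrongDual 𝕜 X ≃ₗᵢ[𝕜] StrongDual 𝕜 Y :=
    LinearIsometryEquiv.ofSurjective ⟨T₀, hnorm⟩ fun g => (hex g).imp fun f hf => hf.2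
  let Φ : StrongDual 𝕜 (StrongDual 𝕜 Y) ≃ₗᵢ[𝕜] StrongDual 𝕜 (StrongDual 𝕜 X) :=
    { toFun := fun ψ => ψ.comp (T : StrongDual 𝕜 X →L[𝕜] StrongDual 𝕜 Y)
      invFun := fun x => x.comp (T.symm : StrongDual 𝕜 Y →L[𝕜] StrongDual 𝕜 X)
      left_inv := fun ψ => ContinuousLinearMap.ext fun g => congrArg ψ (T.apply_symm_apply g)
      right_inv := fun x => ContinuousLinearMap.ext fun f => congrArg x (T.symm_apply_apply f)
      map_add' := fun _ _ => rfl
      map_smul' := fun _ _ => rfl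
      norm_map' := fun ψ => ψ.opNorm_comp_linearIsometryEquiv T }
  exact ⟨T, Φ, fun _ _ => rfl, fun y => ContinuousLinearMap.ext fun f => rfl⟩

/-- In the bidual of a nonreflexive M-embedded space `X`, for each nonzero `f ∈ X^*` there is a
closed subspace with the same bidual that is not contained in `X` and meets `X` only in the kernel
of `f`. -/
theorem IsMEmbedded.exists_hasSameBidual (hM : IsMEmbedded 𝕜 X) (hX : ¬ IsReflexiveSpace 𝕜 X)
    {f : StrongDual 𝕜 X} (hf : f ≠ 0) :
    ∃ Y : NormedSubspace 𝕜 (StrongDual 𝕜 (StrongDual 𝕜 X)),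
      IsClosed (Y : Set (StrongDual 𝕜 (StrongDual 𝕜 X))) ∧ HasSameBidual 𝕜 Y ∧
        ¬ Y ≤ canonicalImage 𝕜 X ∧ ∀ y ∈ Y, y ∈ canonicalImage 𝕜 X → y f = 0 := by
  obtain ⟨x₁, hx₁⟩ : ∃ x, f x ≠ 0 := by
    by_contra! h
    exact hf (ContinuousLinearMap.ext h)
  obtain ⟨u, hu⟩ : ∃ u, u ∉ canonicalImage 𝕜 X := by
    by_contra! h
    exact hX h
  obtain ⟨x₀, hx₀⟩ : ∃ x₀, f x₀ = 1 := ⟨(f x₁)⁻¹ • x₁, by simp [hx₁]⟩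
  -- an element `z` outside `X` that vanishes at `f`, small enough for the norm estimate below
  obtain ⟨z, hz, hzf, hzn⟩ : ∃ z : StrongDual 𝕜 (StrongDual 𝕜 X),
      z ∉ canonicalImage 𝕜 X ∧ z f = 0 ∧ ‖z‖ * ‖f‖ ≤ 1 := by
    set v := u - u f • inclusionInDoubleDual 𝕜 X x₀ with hv
    have hvX : v ∉ canonicalImage 𝕜 X := fun h => hu (by
      have := (canonicalImage 𝕜 X).add_mem h
        ((canonicalImage 𝕜 X).smul_mem (u f) ⟨x₀, rfl⟩)
      simpa [hv] using this)
    have hpos : (0 : ℝ) < ‖v‖ * ‖f‖ + 1 := by positivity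
    have hc : (((‖v‖ * ‖f‖ + 1)⁻¹ : ℝ) : 𝕜) ≠ 0 :=
      RCLike.ofReal_ne_zero.2 (inv_pos.2 hpos).ne'
    refine ⟨(((‖v‖ * ‖f‖ + 1)⁻¹ : ℝ) : 𝕜) • v, ?_, ?_, ?_⟩
    · rwa [Submodule.smul_mem_iff _ hc]
    · simp [hv, hx₀]
    · rw [norm_smul, RCLike.norm_ofReal, abs_of_pos (inv_pos.2 hpos), mul_assoc,
        inv_mul_le_iff₀ hpos]
      linarith
  -- Since `z f = 0`, `Q` is inverse to `y ↦ y + y(f) z`; thus the preimage of `X` is closed and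
  -- consists of the points `x + f(x) z`.
  let Q : StrongDual 𝕜 (StrongDual 𝕜 X) →L[𝕜] StrongDual 𝕜 (StrongDual 𝕜 X) :=
    ContinuousLinearMap.id 𝕜 _ - (inclusionInDoubleDual 𝕜 (StrongDual 𝕜 X) f).smulRight z
  have hQ : ∀ y, Q y = y - y f • z := fun y => by simp [Q]
  let Y : NormedSubspace 𝕜 (StrongDual 𝕜 (StrongDual 𝕜 X)) :=
    (canonicalImage 𝕜 X).comap (Q : _ →ₗ[𝕜] _)
  have hYmem : ∀ y, y ∈ Y ↔ y - y f • z ∈ canonicalImage 𝕜 X := fun y => by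
    rw [← hQ]; rfl
  have hadd : ∀ x : X, inclusionInDoubleDual 𝕜 X x + f x • z ∈ Y := fun x => by
    rw [hYmem]
    exact ⟨x, by simp [hzf]⟩
  refine ⟨Y, hM.1.preimage Q.continuous, hasSameBidual_of_exists_eval ?_ ?_, ?_, ?_⟩
  · intro k hk
    -- Vanishing on `Y` makes `k` a multiple of `f`, and `z` kills `f`.
    have h1 : ∀ x, k x + f x * z k = 0 := fun x => by simpa using hk _ (hadd x)
    have h2 : k = -(z k) • f := by
      ext x
      rw [smul_apply, smul_eq_mul]
      linear_combination h1 x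
    have h3 : z k = 0 := by
      rw [h2, map_smul, hzf, smul_zero]
    rw [h2, h3, neg_zero, zero_smul]
  · intro g
    obtain ⟨ψ, hψ, hψn⟩ := exists_extension_norm_eq Y g
    set h := ψ.comp (inclusionInDoubleDual 𝕜 X) with hh
    set ρ := ψ - inclusionInDoubleDual 𝕜 (StrongDual 𝕜 X) h with hρ
    have hsum : ‖ψ‖ = ‖h‖ + ‖ρ‖ := hM.norm_eq_add ψ
    refine ⟨h + ρ z • f, ?_, fun y => ?_⟩
    · calc ‖h + ρ z • f‖ ≤ ‖h‖ + ‖ρ z‖ * ‖f‖ := (norm_add_le _ _).trans_eq (by rw [norm_smul])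
        _ ≤ ‖h‖ + ‖ρ‖ * (‖z‖ * ‖f‖) := by
          rw [← mul_assoc]
          gcongr
          exact ρ.le_opNorm z
        _ ≤ ‖h‖ + ‖ρ‖ := by
          gcongr
          exact mul_le_of_le_one_right (norm_nonneg _) hzn
        _ = ‖g‖ := by rw [← hsum, hψn]
    -- `y - y(f) z` lies in `X`, where `ρ` vanishes, so `ρ(y) = y(f) ρ(z)`.
    · obtain ⟨x, hx⟩ := (hYmem y).1 y.2
      have hρx : ρ ((y : StrongDual 𝕜 (StrongDual 𝕜 X)) -
          (y : StrongDual 𝕜 (StrongDual 𝕜 X)) f • z) = 0 := by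
        rw [← hx]
        simp [hρ, hh]
      rw [map_sub, map_smul, sub_eq_zero, hρ, sub_apply, sub_apply, dual_def, hψ] at hρx
      rw [map_add, map_smul, hρ, sub_apply, dual_def]
      simp only [smul_eq_mul, dual_def] at hρx ⊢
      linear_combination hρx
  · intro hle
    have h1 := hle (hadd x₀)
    rw [hx₀, one_smul] at h1
    exact hz (((canonicalImage 𝕜 X).add_mem_iff_right ⟨x₀, rfl⟩).1 h1)
  · intro y hy hyX
    by_contra hyf
    have h1 := (canonicalImage 𝕜 X).sub_mem hyX ((hYmem y).1 hy)
    rw [sub_sub_cancel, Submodule.smul_mem_iff _ hyf] at h1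
    exact hz h1

end

theorem theoremt3p5 (𝕜 : Type*) [RCLike 𝕜] (X : Type*) [NormedAddCommGroup X] [NormedSpace 𝕜 X]
    [CompleteSpace X] (hM : IsMEmbedded 𝕜 X) (hX : ¬ IsReflexiveSpace 𝕜 X) :
    (∃ Y : NormedSubspace 𝕜 (StrongDual 𝕜 (StrongDual 𝕜 X)),
      IsClosed (Y : Set (StrongDual 𝕜 (StrongDual 𝕜 X))) ∧
        HasSameBidual 𝕜 Y ∧ ¬ Y ≤ canonicalImage 𝕜 X) ∧
    ∀ x : StrongDual 𝕜 (StrongDual 𝕜 X), ¬ IsWeakStarWeakContinuityPoint 𝕜 x := by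
  constructor
  · obtain ⟨f, hf⟩ : ∃ f : StrongDual 𝕜 X, f ≠ 0 := by
      by_contra! h
      refine hX fun u => ⟨0, ContinuousLinearMap.ext fun f => ?_⟩
      rw [h f, map_zero, map_zero]
    obtain ⟨Y, hYc, hYb, hYX, -⟩ := hM.exists_hasSameBidual hX hf
    exact ⟨Y, hYc, hYb, hYX⟩
  · intro x hx
    have hxX := hx.mem_of_norming hM.1 norm_le_of_forall_mem_canonicalImage
    have hx0 : x = 0 := by
      ext f
      rcases eq_or_ne f 0 with rfl | hf
      · simp
      obtain ⟨Y, hYc, hYb, -, hYf⟩ := hM.exists_hasSameBidual hX hf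
      exact hYf x (hx.mem_of_norming hYc hYb.norm_le) hxX
    subst hx0
    have htop := hx.eq_top_of_norming hM.1 norm_le_of_forall_mem_canonicalImage
    exact hX fun u => (htop ▸ Submodule.mem_top : u ∈ canonicalImage 𝕜 X)
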